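/- Throughout, a distribution is a probability distribution $F$ on $\mathbb{R}$ with unbounded support contained in $[0,\infty)$; $\overline F(x)=F((x,\infty))$ denotes its tail, $F^{*2}$ its convolution with itself, and all limits without specification are for $x\to\infty$. Define the following classes of distributions. - $\mathcal{K}$ (heavy-tailed): $\int_0^\infty e^{\alpha y}\,dF(y)=\infty$ for all $\alpha>0$. - $\mathcal{J}$: for all $n\ge 2$, if $X_1,\dots,X_n$ are i.i.d. with distribution $F$, then $\lim_{K\to\infty}\liminf_{x\to\infty}\mathbb{P}\big(\max_{1\le i\le n}X_i>x-K\,\big|\,\sum_{i=1}^nX_i>x\big)=1$. - $\mathcal{S}$ (subexponential): $\lim\overline{F^{*2}}(x)/\overline F(x)=2$. - $\mathcal{L}$ (long-tailed): $\lim\overline F(x-t)/\overline F(x)=1$ for all $t>0$. - $\mathcal{D}$ (dominatedly varying): $\limsup\overline F(x/2)/\overline F(x)<\infty$. - $\mathcal{DK}_1$: $\lim x^{\delta}\,\overline F(x)=\infty$ for some $\delta>0$. Two distributions $F$ and $G$ are weakly tail equivalent if $0<\liminf\overline F(x)/\overline G(x)\le\limsup\overline F(x)/\overline G(x)<\infty$.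 **Theorem.** The class $(\mathcal{J}\cap\mathcal{K})\setminus(\mathcal{L}\cup\mathcal{D})$ is non-empty. Moreover, its intersection with $\mathcal{DK}_1$ and its intersection with the complement of $\mathcal{DK}_1$ are both non-empty, and each of these two subclasses contains a distribution which is weakly tail equivalent to some distribution in $\mathcal{S}$ and a distribution which is not weakly tail equivalent to any distribution in $\mathcal{S}$. -/

import Mathlib

open MeasureTheory ProbabilityTheory Filter Topology Set
open scoped ENNReal

/-- A probability distribution on `ℝ` with unbounded support contained in `[0, ∞)`. -/
structure HalfLineDist where
  /-- The distribution as a measure on `ℝ`. -/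
  law : Measure ℝ
  isProbabilityMeasure : IsProbabilityMeasure law
  /-- The support is contained in `[0, ∞)`. -/
  law_Iio_zero : law (Iio 0) = 0
  /-- The support is unbounded. -/
  law_Ioi_pos : ∀ x : ℝ, 0 < law (Ioi x)

namespace HalfLineDist

/-- The tail `x ↦ ν (x, ∞)` of a measure on `ℝ`. All tails below are tails of probability
measures, and every tail that occurs as a denominator is positive. -/
noncomputable def tail (ν : Measure ℝ) (x : ℝ) : ℝ≥0∞ := ν (Ioi x)

/-- `𝒦`, heavy-tailed distributions: `∫ e^{α y} dF(y) = ∞` for all `α > 0`. -/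
def classK : Set HalfLineDist :=
  {F | ∀ α : ℝ, 0 < α → ∫⁻ y, ENNReal.ofReal (Real.exp (α * y)) ∂F.law = ∞}

/-- The joint law, on `ℝⁿ`, of `n` independent random variables with distribution `F`. -/
noncomputable def iidLaw (F : HalfLineDist) (n : ℕ) : Measure (Fin n → ℝ) :=
  Measure.pi fun _ : Fin n => F.law

/-- `𝒥`: for all `n ≥ 2`, with `X₁, …, Xₙ` i.i.d. of distribution `F`,
`lim_{K → ∞} liminf_{x → ∞} P (max Xᵢ > x - K ∣ X₁ + ⋯ + Xₙ > x) = 1`. -/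
def classJ : Set HalfLineDist :=
  {F | ∀ n : ℕ, 2 ≤ n →
    Tendsto (fun K : ℝ =>
      liminf (fun x : ℝ =>
        cond (F.iidLaw n) {X | x < ∑ i, X i} {X | x - K < ⨆ i, X i}) atTop)
      atTop (𝓝 1)}

/-- `𝒮`, subexponential distributions: the tail of `F * F` is asymptotic to twice that of `F`. -/
def classS : Set HalfLineDist :=
  {F | Tendsto (fun x : ℝ => tail (F.law.conv F.law) x / tail F.law x) atTop (𝓝 2)}

/-- `ℒ`, long-tailed distributions. -/
def classL : Set HalfLineDist :=
  {F | ∀ t : ℝ, 0 < t →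
    Tendsto (fun x : ℝ => tail F.law (x - t) / tail F.law x) atTop (𝓝 1)}

/-- `𝒟`, dominatedly varying distributions. -/
def classD : Set HalfLineDist :=
  {F | limsup (fun x : ℝ => tail F.law (x / 2) / tail F.law x) atTop < ∞}

/-- `𝒟𝒦₁`: for some `δ > 0`, `x ^ δ` times the tail of `F` tends to infinity. -/
def classDK₁ : Set HalfLineDist :=
  {F | ∃ δ : ℝ, 0 < δ ∧
    Tendsto (fun x : ℝ => ENNReal.ofReal (x ^ δ) * tail F.law x) atTop (𝓝 ∞)}

/-- Weak tail equivalence of two distributions. -/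
def WeakTailEquiv (F G : HalfLineDist) : Prop :=
  0 < liminf (fun x : ℝ => tail F.law x / tail G.law x) atTop ∧
    limsup (fun x : ℝ => tail F.law x / tail G.law x) atTop < ∞

/-- Distributions that are weakly tail equivalent to some subexponential distribution. -/
def weakS : Set HalfLineDist := {F | ∃ G ∈ classS, WeakTailEquiv F G}

end HalfLineDist

/-! Write the tail as `exp (-g)`. If `g x - g (x - y) ≤ 3/4 * g y + c` for `0 ≤ 2y ≤ x`, and `g` is
within 1 of a continuous function, then `exp (3/4 * g X)` is integrable, and splitting at `x / 2`
shows that two summands above `K` with sum above `x` are negligible against the tail at `x`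
(`IsHazard.singleBigJump`). This two-variable condition passes to `n` summands and gives `𝒥`
(`SingleBigJump.mem_classJ`); together with long-tailedness it gives `𝒮`
(`SingleBigJump.mem_classS`).

The examples have hazard `B + rampSum w`. The base `B` is `log (1 + x)` (inside `𝒟𝒦₁`) or `√x`
(outside). The `m`-th ramp climbs logarithmically by `m` between `start m` and `2 * start m`, which
rules out `𝒟`; the starts are so sparse that the ramps together stay below `log (1 + x)`.

The scale `w` decides weak tail equivalence to `𝒮`. Members of `weakS` satisfy `tail (x - t) ≤ C *
tail x` eventually, with `C` independent of `t`. At scale 1, windows of fixed length raise the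
hazard by any prescribed `n` arbitrarily far out, so this fails, and `ℒ` fails too. At scale `m + 1`
the ramps flatten and the law is in `𝒮`; taking the floor of its hazard destroys `ℒ` but changes the
tail by at most a factor `e`. -/

namespace HalfLineDist

attribute [instance] HalfLineDist.isProbabilityMeasure

instance (F : HalfLineDist) (n : ℕ) : IsProbabilityMeasure (F.iidLaw n) := by
  unfold iidLaw; infer_instance

/-! ### Tails and two independent copies. -/

lemma tail_antitone (ν : Measure ℝ) : Antitone (tail ν) := fun _ _ h =>
  measure_mono (Ioi_subset_Ioi h)

lemma tail_le_one (F : HalfLineDist) (x : ℝ) : tail F.law x ≤ 1 := prob_le_one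

lemma tail_ne_zero (F : HalfLineDist) (x : ℝ) : tail F.law x ≠ 0 := (F.law_Ioi_pos x).ne'

lemma tail_ne_top (F : HalfLineDist) (x : ℝ) : tail F.law x ≠ ∞ := measure_ne_top _ _

lemma ae_nonneg (F : HalfLineDist) : ∀ᵐ y ∂F.law, 0 ≤ y := by
  rw [ae_iff]; simpa [← Iio_def] using F.law_Iio_zero

lemma tail_of_neg (F : HalfLineDist) {x : ℝ} (hx : x < 0) : tail F.law x = 1 := by
  refine le_antisymm (F.tail_le_one x) ?_
  rw [← (prob_compl_eq_zero_iff (μ := F.law) (measurableSet_Ioi (a := x))).1 ?_, tail]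
  exact measure_mono_null (fun y hy => by simp at hy ⊢; linarith) F.law_Iio_zero

lemma tendsto_tail (F : HalfLineDist) : Tendsto (tail F.law) atTop (𝓝 0) := by
  have h := tendsto_measure_Iic_atTop F.law
  rw [measure_univ] at h
  have h2 := ENNReal.Tendsto.sub (tendsto_const_nhds (x := (1 : ℝ≥0∞)) (f := atTop)) h
    (Or.inl ENNReal.one_ne_top)
  simp only [tsub_self] at h2
  refine h2.congr fun x => ?_
  rw [← prob_compl_eq_one_sub (measurableSet_Iic (a := x)), compl_Iic, tail]

/-- The probability that two independent copies both exceed `K` while their sum exceeds `x`. -/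
noncomputable def jointExcess (F : HalfLineDist) (K x : ℝ) : ℝ≥0∞ :=
  (F.law.prod F.law) {p | K < p.1 ∧ K < p.2 ∧ x < p.1 + p.2}

/-- The event that two independent copies both exceed `K` and their sum exceeds `x` is negligible
with respect to the tail at `x`, for large `K`. -/
def SingleBigJump (F : HalfLineDist) : Prop :=
  ∀ ε : ℝ≥0∞, 0 < ε → ∃ K : ℝ, 0 ≤ K ∧ ∀ᶠ x in atTop, F.jointExcess K x ≤ ε * tail F.law x

lemma measurableSet_sum_gt (x : ℝ) : MeasurableSet {p : ℝ × ℝ | x < p.1 + p.2} :=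
  measurableSet_lt measurable_const (by fun_prop)

lemma tail_conv (F : HalfLineDist) (x : ℝ) :
    tail (F.law.conv F.law) x = (F.law.prod F.law) {p | x < p.1 + p.2} := by
  rw [tail, Measure.conv, Measure.map_apply (by fun_prop) measurableSet_Ioi]; rfl

lemma prod_fst_mem_sum_gt (F : HalfLineDist) {A : Set ℝ} (hA : MeasurableSet A) (x : ℝ) :
    (F.law.prod F.law) {p | p.1 ∈ A ∧ x < p.1 + p.2} = ∫⁻ y in A, tail F.law (x - y) ∂F.law := by
  have hS : MeasurableSet {p : ℝ × ℝ | p.1 ∈ A ∧ x < p.1 + p.2} :=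
    (measurable_fst hA).inter (measurableSet_sum_gt x)
  rw [Measure.prod_apply hS, ← lintegral_indicator hA]
  refine lintegral_congr fun y => ?_
  by_cases hy : y ∈ A
  · simp only [hy, indicator_of_mem, tail]
    congr 1; ext z; simp [hy, sub_lt_iff_lt_add']
  · simp [hy]

lemma tail_conv_le (F : HalfLineDist) (K x : ℝ) :
    tail (F.law.conv F.law) x ≤ 2 * tail F.law (x - K) + F.jointExcess K x := by
  rw [tail_conv]
  calc (F.law.prod F.law) {p | x < p.1 + p.2}
      ≤ (F.law.prod F.law) ((Ioi (x - K) ×ˢ univ ∪ univ ×ˢ Ioi (x - K)) ∪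
          {p | K < p.1 ∧ K < p.2 ∧ x < p.1 + p.2}) := by
        refine measure_mono fun p hp => ?_
        simp only [mem_ofPred_eq] at hp
        by_cases h1 : K < p.1
        · by_cases h2 : K < p.2
          · exact Or.inr ⟨h1, h2, hp⟩
          · refine Or.inl (Or.inl ⟨?_, mem_univ _⟩)
            simp only [mem_Ioi]; linarith
        · refine Or.inl (Or.inr ⟨mem_univ _, ?_⟩)
          simp only [mem_Ioi]; linarith
    _ ≤ _ := by
        refine (measure_union_le _ _).trans (add_le_add ((measure_union_le _ _).trans ?_) le_rfl)
        rw [Measure.prod_prod, Measure.prod_prod, measure_univ, mul_one, one_mul, two_mul]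
        rfl

lemma tail_sub_mul_tail_le (F : HalfLineDist) {K t x : ℝ} (h1 : K ≤ t) (h2 : K ≤ x - t) :
    tail F.law (x - t) * tail F.law t ≤ F.jointExcess K x := by
  rw [tail, tail, ← Measure.prod_prod]
  refine measure_mono fun p hp => ?_
  simp only [mem_prod, mem_Ioi] at hp
  exact ⟨by linarith, by linarith, by linarith⟩

/-- For a fixed `t`, one copy above `x - t` and the other above `t` is a joint excess, so `tail (x -
t) * tail t` is at most the tail at `x`; divide by the constant `tail t`. -/
lemma SingleBigJump.exists_tail_sub_le {F : HalfLineDist} (hF : F.SingleBigJump) (K : ℝ) :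
    ∃ C : ℝ≥0∞, C ≠ ∞ ∧ ∀ᶠ x in atTop, tail F.law (x - K) ≤ C * tail F.law x := by
  obtain ⟨K₀, -, h⟩ := hF 1 one_pos
  set t := max K K₀
  refine ⟨(tail F.law t)⁻¹, ENNReal.inv_ne_top.2 (F.tail_ne_zero t), ?_⟩
  filter_upwards [h, eventually_ge_atTop (K₀ + t)] with x hx hx2
  have h1 := (F.tail_sub_mul_tail_le (le_max_right K K₀) (by linarith : K₀ ≤ x - t)).trans hx
  rw [one_mul] at h1
  rw [← ENNReal.div_eq_inv_mul,
    ENNReal.le_div_iff_mul_le (Or.inl (F.tail_ne_zero t)) (Or.inl (F.tail_ne_top t))]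
  refine le_trans ?_ h1
  gcongr
  exact tail_antitone _ (by linarith [le_max_left K K₀])

/-- Integrating against `f (x - y)` requires the bound at all arguments, not only large ones. Left
of the threshold the tail is bounded below, so a larger constant suffices. -/
lemma exists_forall_le_mul_tail (F : HalfLineDist) {f : ℝ → ℝ≥0∞} (hf : ∀ x, f x ≤ 1)
    {C : ℝ≥0∞} (hC : C ≠ ∞) (h : ∀ᶠ x in atTop, f x ≤ C * tail F.law x) :
    ∃ C' : ℝ≥0∞, C' ≠ ∞ ∧ ∀ x, f x ≤ C' * tail F.law x := by
  obtain ⟨x₀, hx₀⟩ := eventually_atTop.1 h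
  refine ⟨C + (tail F.law x₀)⁻¹,
    ENNReal.add_ne_top.2 ⟨hC, ENNReal.inv_ne_top.2 (F.tail_ne_zero x₀)⟩, fun x => ?_⟩
  rw [add_mul]
  rcases le_total x₀ x with hx | hx
  · exact (hx₀ x hx).trans le_self_add
  · refine (hf x).trans (le_trans ?_ le_add_self)
    rw [← ENNReal.inv_mul_cancel (F.tail_ne_zero x₀) (F.tail_ne_top x₀)]
    gcongr
    exact tail_antitone _ hx

lemma SingleBigJump.exists_tail_conv_le {F : HalfLineDist} (hF : F.SingleBigJump) :
    ∃ C : ℝ≥0∞, C ≠ ∞ ∧ ∀ x, tail (F.law.conv F.law) x ≤ C * tail F.law x := by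
  obtain ⟨K, -, hK⟩ := hF 1 one_pos
  obtain ⟨C, hC, h⟩ := hF.exists_tail_sub_le K
  refine F.exists_forall_le_mul_tail (C := 2 * C + 1) (fun x => by rw [tail_conv]; exact prob_le_one)
    (by finiteness) ?_
  filter_upwards [hK, h] with x h1 h2
  calc _ ≤ _ := F.tail_conv_le K x
    _ ≤ 2 * (C * tail F.law x) + 1 * tail F.law x := by gcongr
    _ = _ := by ring

/-! ### Sums of `n` copies and the class `𝒥`. -/

/-- The tail of the sum of `n` independent copies. -/
noncomputable def sumTail (F : HalfLineDist) (n : ℕ) (x : ℝ) : ℝ≥0∞ :=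
  F.iidLaw n {X | x < ∑ i, X i}

lemma iidLaw_succ_apply (F : HalfLineDist) (n : ℕ) (i : Fin (n + 1)) {A : Set ℝ}
    (hA : MeasurableSet A) (x : ℝ) :
    F.iidLaw (n + 1) {X | X i ∈ A ∧ x < ∑ j, X j} =
      ∫⁻ y in A, F.sumTail n (x - y) ∂F.law := by
  have hmp := measurePreserving_piFinSuccAbove (fun _ : Fin (n + 1) => F.law) i
  have hS : MeasurableSet {p : ℝ × (Fin n → ℝ) | p.1 ∈ A ∧ x < p.1 + ∑ j, p.2 j} :=
    (measurable_fst hA).inter (measurableSet_lt measurable_const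
      (g := fun p : ℝ × (Fin n → ℝ) => p.1 + ∑ j, p.2 j) (by fun_prop))
  have key : {X : Fin (n + 1) → ℝ | X i ∈ A ∧ x < ∑ j, X j} =
      MeasurableEquiv.piFinSuccAbove (fun _ : Fin (n + 1) => ℝ) i ⁻¹'
        {p : ℝ × (Fin n → ℝ) | p.1 ∈ A ∧ x < p.1 + ∑ j, p.2 j} := by
    ext X
    simp only [mem_ofPred_eq, Fin.sum_univ_succAbove _ i, mem_preimage]
    rfl
  rw [iidLaw, key, hmp.measure_preimage hS.nullMeasurableSet, Measure.prod_apply hS,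
    ← lintegral_indicator hA]
  refine lintegral_congr fun y => ?_
  by_cases hy : y ∈ A
  · simp only [hy, indicator_of_mem, sumTail, iidLaw]
    congr 1; ext z; simp [hy, sub_lt_iff_lt_add']
  · simp [hy]

/-- Conditioning on one coordinate and bounding the tail of the remaining sum by a multiple of a
single tail leaves the tail of a two-fold convolution. -/
lemma SingleBigJump.exists_sumTail_le {F : HalfLineDist} (hF : F.SingleBigJump) (n : ℕ) :
    ∃ C : ℝ≥0∞, C ≠ ∞ ∧ ∀ x, F.sumTail n x ≤ C * tail F.law x := by
  induction n with
  | zero =>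
    refine ⟨1, ENNReal.one_ne_top, fun x => ?_⟩
    -- The empty sum exceeds `x` only for negative `x`, where the tail is 1.
    rcases lt_or_ge x 0 with hx | hx
    · rw [F.tail_of_neg hx, one_mul]; exact prob_le_one
    · simp [sumTail, not_lt.2 hx]
  | succ n ih =>
    obtain ⟨C, hC, h⟩ := ih
    obtain ⟨C₂, hC₂, h₂⟩ := hF.exists_tail_conv_le
    refine ⟨C * C₂, by finiteness, fun x => ?_⟩
    have h3 := F.iidLaw_succ_apply n 0 MeasurableSet.univ x
    have h4 := F.prod_fst_mem_sum_gt MeasurableSet.univ x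
    simp only [mem_univ, true_and] at h3 h4
    rw [sumTail, h3, mul_assoc]
    calc _ ≤ ∫⁻ y in univ, C * tail F.law (x - y) ∂F.law := lintegral_mono fun y => h _
      _ = C * tail (F.law.conv F.law) x := by
        rw [lintegral_const_mul' _ _ hC, ← h4, tail_conv]
      _ ≤ _ := by gcongr; exact h₂ x

/-- Some coordinate is at least `x / (n + 1)`; being at most `x - K`, it forces the others to sum to
more than `K`. Replacing their sum by a single copy, at the cost of a constant, gives a joint
excess. -/
lemma SingleBigJump.exists_no_big_jump_le {F : HalfLineDist} (hF : F.SingleBigJump) {n : ℕ}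
    {ε : ℝ≥0∞} (hε : 0 < ε) :
    ∃ K₀ : ℝ, ∀ K, K₀ ≤ K → ∀ᶠ x in atTop,
      F.iidLaw (n + 1) {X | (∀ i, X i ≤ x - K) ∧ x < ∑ i, X i} ≤ ε * tail F.law x := by
  obtain ⟨C, hC, hsum⟩ := hF.exists_sumTail_le n
  obtain ⟨K₀, hK₀, h⟩ := hF (ε / ((n + 1 : ℕ) * (C + 1)))
    (ENNReal.div_pos hε.ne' (by finiteness))
  refine ⟨K₀ + 1, fun K hK => ?_⟩
  filter_upwards [h, eventually_gt_atTop ((n + 1) * K₀)] with x hx hxK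
  have hn : (0 : ℝ) < n + 1 := by positivity
  have hxn : K₀ < x / (n + 1) := by rwa [lt_div_iff₀' hn]
  have one : ∀ i : Fin (n + 1),
      F.iidLaw (n + 1) {X | X i ∈ Icc (x / (n + 1)) (x - K) ∧ x < ∑ j, X j} ≤
        C * F.jointExcess K₀ x := fun i => by
    rw [iidLaw_succ_apply _ _ _ measurableSet_Icc]
    calc _ ≤ ∫⁻ y in Icc (x / (n + 1)) (x - K), C * tail F.law (x - y) ∂F.law :=
          lintegral_mono fun y => hsum _
      _ = C * (F.law.prod F.law)
            {p | p.1 ∈ Icc (x / ((n : ℝ) + 1)) (x - K) ∧ x < p.1 + p.2} := by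
          rw [lintegral_const_mul' _ _ hC, prod_fst_mem_sum_gt _ measurableSet_Icc]
      _ ≤ _ := by
          gcongr
          refine measure_mono fun p hp => ?_
          obtain ⟨⟨h1, h2⟩, h3⟩ := hp
          exact ⟨by linarith, by linarith, h3⟩
  calc _ ≤ F.iidLaw (n + 1)
        (⋃ i : Fin (n + 1), {X | X i ∈ Icc (x / (n + 1)) (x - K) ∧ x < ∑ j, X j}) := by
        refine measure_mono fun X hX => ?_
        obtain ⟨h1, h2⟩ := hX
        obtain ⟨i, -, hi⟩ : ∃ i ∈ Finset.univ, x / (n + 1) ≤ X i := by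
          refine Finset.exists_le_of_sum_le Finset.univ_nonempty ?_
          simp only [Finset.sum_const, Finset.card_univ, Fintype.card_fin, nsmul_eq_mul]
          push_cast
          rw [mul_div_cancel₀ _ hn.ne']
          exact h2.le
        exact mem_iUnion.2 ⟨i, ⟨hi, h1 i⟩, h2⟩
    _ ≤ ∑ i : Fin (n + 1), C * F.jointExcess K₀ x :=
        (measure_iUnion_fintype_le _ _).trans (Finset.sum_le_sum fun i _ => one i)
    _ = (n + 1 : ℕ) * (C * F.jointExcess K₀ x) := by simp
    _ ≤ (n + 1 : ℕ) * ((C + 1) * (ε / ((n + 1 : ℕ) * (C + 1)) * tail F.law x)) := by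
        gcongr; exact le_self_add
    _ = ((n + 1 : ℕ) * (C + 1)) * (ε / ((n + 1 : ℕ) * (C + 1))) * tail F.law x := by ring
    _ = ε * tail F.law x := by
        rw [ENNReal.mul_div_cancel (by simp) (by finiteness)]

/-- Lets bounds relative to the tail become bounds relative to the conditioning event of `𝒥`. -/
lemma tail_le_sumTail (F : HalfLineDist) (n : ℕ) (x : ℝ) :
    tail F.law x ≤ F.sumTail (n + 1) x := by
  have h := F.iidLaw_succ_apply n 0 (measurableSet_Ioi (a := x)) x
  refine le_trans ?_ (measure_mono (fun X hX => hX.2 : {X : Fin (n + 1) → ℝ |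
    X 0 ∈ Ioi x ∧ x < ∑ j, X j} ⊆ _))
  rw [h, tail, ← setLIntegral_one]
  refine setLIntegral_mono_ae' measurableSet_Ioi (Eventually.of_forall fun y hy => ?_)
  have h0 : ∀ᵐ X ∂F.iidLaw n, ∀ i, 0 ≤ X i := by
    rw [eventually_countable_forall]
    exact fun i => (Measure.tendsto_eval_ae_ae (μ := fun _ : Fin n => F.law)).eventually F.ae_nonneg
  have : F.sumTail n (x - y) = 1 := by
    rw [sumTail, ← mem_ae_iff_prob_eq_one₀
      (measurableSet_lt measurable_const (by fun_prop)).nullMeasurableSet]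
    filter_upwards [h0] with X hX
    have := Finset.sum_nonneg fun i (_ : i ∈ Finset.univ) => hX i
    simp only [mem_Ioi] at hy
    change x - y < _
    linarith
  exact this.ge

lemma SingleBigJump.mem_classJ {F : HalfLineDist} (hF : F.SingleBigJump) : F ∈ classJ := by
  intro n hn
  obtain ⟨n, rfl⟩ : ∃ k, n = k + 1 := ⟨n - 1, by omega⟩
  have hmeas : ∀ x : ℝ, MeasurableSet {X : Fin (n + 1) → ℝ | x < ∑ i, X i} := fun x =>
    measurableSet_lt measurable_const (by fun_prop)
  have hle : ∀ K x : ℝ, cond (F.iidLaw (n + 1)) {X | x < ∑ i, X i} {X | x - K < ⨆ i, X i} ≤ 1 := by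
    intro K x
    rw [cond_apply (hmeas x), ← ENNReal.div_eq_inv_mul]
    exact ENNReal.div_le_of_le_mul (by rw [one_mul]; exact measure_mono inter_subset_left)
  refine tendsto_order.2 ⟨fun a ha => ?_, fun a ha => Eventually.of_forall fun K => ?_⟩
  · obtain ⟨b, hab, hb⟩ := exists_between ha
    have hε : 0 < 1 - b := tsub_pos_of_lt hb
    obtain ⟨K₀, h⟩ := hF.exists_no_big_jump_le (n := n) hε
    filter_upwards [eventually_ge_atTop K₀] with K hK
    refine hab.trans_le (le_liminf_of_le (by isBoundedDefault) ?_)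
    filter_upwards [h K hK] with x hx
    set μ := F.iidLaw (n + 1)
    set A : Set (Fin (n + 1) → ℝ) := {X | x < ∑ i, X i}
    set B : Set (Fin (n + 1) → ℝ) := {X | x - K < ⨆ i, X i}
    have hA0 : μ A ≠ 0 := ((F.law_Ioi_pos x).trans_le (F.tail_le_sumTail n x)).ne'
    have hAB : μ A ≤ μ (A ∩ B) + (1 - b) * μ A := by
      refine (measure_mono ?_).trans ((measure_union_le (A ∩ B) _).trans
        (add_le_add le_rfl (hx.trans (mul_le_mul_right (F.tail_le_sumTail n x) _))))
      intro X hX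
      by_cases hB : X ∈ B
      · exact Or.inl ⟨hX, hB⟩
      · refine Or.inr ⟨fun i => ?_, hX⟩
        exact (le_ciSup (finite_range X).bddAbove i).trans (not_lt.1 hB)
    rw [cond_apply (hmeas x), ← ENNReal.div_eq_inv_mul,
      ENNReal.le_div_iff_mul_le (Or.inl hA0) (Or.inl (measure_ne_top _ _))]
    have h1 : μ A = b * μ A + (1 - b) * μ A := by
      rw [← add_mul, add_tsub_cancel_of_le hb.le, one_mul]
    have h2 : (1 - b) * μ A ≠ ∞ := by finiteness
    exact (ENNReal.add_le_add_iff_right h2).1 (h1.symm.trans_le hAB)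
  · refine lt_of_le_of_lt ?_ ha
    exact (liminf_le_liminf (Eventually.of_forall (hle K))).trans (by simp)

/-! ### Subexponentiality and bounds under shifts. -/

/-- The three terms are disjoint pieces of the event: first copy above `x`; first copy at most `t`
and second above `x`; first copy in `(t, x]` and second above `x - t`. -/
lemma le_tail_conv (F : HalfLineDist) {t x : ℝ} (htx : t ≤ x) :
    tail F.law x + (1 - tail F.law t) * tail F.law x +
      (tail F.law t - tail F.law x) * tail F.law (x - t) ≤ tail (F.law.conv F.law) x := by
  have hIcc : F.law (Icc 0 t) = 1 - tail F.law t := by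
    rw [tail, ← prob_compl_eq_one_sub measurableSet_Ioi, compl_Ioi]
    exact measure_congr (by
      filter_upwards [F.ae_nonneg] with y hy
      exact propext ⟨fun h => h.2, fun h => ⟨hy, h⟩⟩)
  have hIoc : F.law (Ioc t x) = tail F.law t - tail F.law x := by
    rw [tail, tail, ← measure_sdiff (Ioi_subset_Ioi htx) measurableSet_Ioi.nullMeasurableSet
      (measure_ne_top _ _)]
    congr 1; ext y; simp
  have hIci : F.law (Ici 0) = 1 := by
    rw [← mem_ae_iff_prob_eq_one measurableSet_Ici]; exact F.ae_nonneg
  have e1 : tail F.law x = (F.law.prod F.law) (Ioi x ×ˢ Ici 0) := by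
    rw [Measure.prod_prod, hIci, mul_one]; rfl
  rw [tail_conv, ← hIcc, ← hIoc]
  calc _ = (F.law.prod F.law) (Ioi x ×ˢ Ici 0) + (F.law.prod F.law) (Icc 0 t ×ˢ Ioi x)
          + (F.law.prod F.law) (Ioc t x ×ˢ Ioi (x - t)) := by
        rw [← e1, Measure.prod_prod, Measure.prod_prod]; rfl
    _ = (F.law.prod F.law) ((Ioi x ×ˢ Ici 0 ∪ Icc 0 t ×ˢ Ioi x) ∪ Ioc t x ×ˢ Ioi (x - t)) := by
        rw [measure_union _ (measurableSet_Ioc.prod measurableSet_Ioi),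
          measure_union _ (measurableSet_Icc.prod measurableSet_Ioi)]
        · refine Set.disjoint_left.2 fun p hp hq => ?_
          have := hp.1; have := hq.1.2; simp only [mem_Ioi] at *; linarith
        · refine Set.disjoint_left.2 fun p hp hq => ?_
          have h1 := hq.1.1; have h2 := hq.1.2
          rcases hp with hp | hp
          · have := hp.1; simp only [mem_Ioi] at *; linarith
          · have := hp.1.2; linarith
    _ ≤ _ := by
        refine measure_mono ?_
        rintro p ((⟨h1, h2⟩ | ⟨h1, h2⟩) | ⟨h1, h2⟩) <;>
          simp only [mem_Ioi, mem_Ici, mem_Icc, mem_Ioc, mem_ofPred_eq] at * <;> grind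

/-- A subexponential tail has a shift bound that is uniform in the shift. -/
lemma eventually_tail_sub_le_of_mem_classS {G : HalfLineDist} (hG : G ∈ classS) (t : ℝ) : ∀ᶠ x in atTop, tail G.law (x - t) ≤ 4 * tail G.law x := by
  set T := tail G.law t
  have hT0 : T ≠ 0 := G.tail_ne_zero t
  have hTt : T ≠ ∞ := G.tail_ne_top t
  -- With `u`, `v` the tails at `x - t` and `x`, `le_tail_conv` gives `(T - v) * u ≤ 2 * T * v`; as
  -- `v < T / 2`, this yields `u ≤ 4 * v`.
  have h1 : ∀ᶠ x in atTop, tail (G.law.conv G.law) x / tail G.law x < 2 + T :=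
    hG.eventually_lt_const (ENNReal.lt_add_right (by simp) hT0)
  have h2 : ∀ᶠ x in atTop, tail G.law x < T / 2 :=
    G.tendsto_tail.eventually_lt_const (ENNReal.half_pos hT0)
  filter_upwards [h1, h2, eventually_ge_atTop t] with x hx1 hx2 hx3
  have h3 := G.le_tail_conv hx3
  have h4 : tail (G.law.conv G.law) x ≤ (2 + T) * tail G.law x := by
    rw [← ENNReal.div_le_iff (G.tail_ne_zero x) (G.tail_ne_top x)]; exact hx1.le
  have h5 := h3.trans h4
  lift tail G.law (x - t) to NNReal using G.tail_ne_top _ with u hu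
  have hT1 : T ≤ 1 := G.tail_le_one t
  change _ + (1 - T) * _ + (T - _) * _ ≤ _ at h5
  generalize T = T' at *
  lift T' to NNReal using hTt
  lift tail G.law x to NNReal using G.tail_ne_top _ with v hv
  have hvT : v ≤ T' := by
    have : (v : ℝ≥0∞) ≤ T' := hx2.le.trans ENNReal.half_le_self
    exact_mod_cast this
  have hT1' : T' ≤ 1 := by exact_mod_cast hT1
  have hvT2 : v < T' / 2 := by
    have : ((T' / 2 : NNReal) : ℝ≥0∞) = T' / 2 := by
      rw [ENNReal.coe_div (by norm_num)]; rfl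
    rw [← this] at hx2; exact_mod_cast hx2
  have h6 : v + (1 - T') * v + (T' - v) * u ≤ (2 + T') * v := by exact_mod_cast h5
  have hT0' : T' ≠ 0 := by simpa using hT0
  suffices u ≤ 4 * v by exact_mod_cast this
  have h7 : (v : ℝ) + (1 - T') * v + (T' - v) * u ≤ (2 + T') * v := by
    have := NNReal.coe_le_coe.2 h6
    push_cast [NNReal.coe_sub hT1', NNReal.coe_sub hvT] at this
    exact this
  have h8 : (v : ℝ) < T' / 2 := by exact_mod_cast hvT2
  have h9 : (0 : ℝ) < T' := by exact_mod_cast pos_iff_ne_zero.2 hT0'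
  have h10 : (0 : ℝ) ≤ u := u.2
  have : (u : ℝ) ≤ 4 * v := by
    by_contra! hc
    nlinarith [mul_nonneg (sub_nonneg.2 h8.le) h10]
  exact_mod_cast this

/-- The obstruction to being in `weakS`: the point is that `C` is chosen before `t`. -/
lemma exists_eventually_tail_sub_le_of_mem_weakS {F : HalfLineDist} (hF : F ∈ weakS) :
    ∃ C : ℝ≥0∞, C ≠ ∞ ∧ ∀ t : ℝ, ∀ᶠ x in atTop, tail F.law (x - t) ≤ C * tail F.law x := by
  obtain ⟨G, hG, h1, h2⟩ := hF
  obtain ⟨c, hc0, hc⟩ := exists_between h1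
  obtain ⟨C, hC, hCt⟩ := exists_between h2
  have hlo := eventually_lt_of_lt_liminf hc
  have hhi := eventually_lt_of_limsup_lt hC
  have hct : c ≠ ∞ := (hc.trans_le le_top).ne
  refine ⟨C * 4 * c⁻¹, by
    have := ENNReal.inv_ne_top.2 hc0.ne'
    have := hCt.ne
    finiteness, fun t => ?_⟩
  have hhi' := (tendsto_atTop_add_const_right atTop (-t) tendsto_id).eventually hhi
  filter_upwards [hlo, hhi', eventually_tail_sub_le_of_mem_classS hG t] with x hx1 hx2 hx3
  simp only [id, ← sub_eq_add_neg] at hx2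
  rw [ENNReal.lt_div_iff_mul_lt (Or.inl (G.tail_ne_zero x)) (Or.inl (G.tail_ne_top x))] at hx1
  rw [ENNReal.div_lt_iff (Or.inl (G.tail_ne_zero _)) (Or.inl (G.tail_ne_top _))] at hx2
  calc _ ≤ C * tail G.law (x - t) := hx2.le
    _ ≤ C * (4 * tail G.law x) := by gcongr
    _ = C * 4 * c⁻¹ * (c * tail G.law x) := by
      rw [mul_assoc (C * 4), ← mul_assoc c⁻¹, ENNReal.inv_mul_cancel hc0.ne' hct]; ring
    _ ≤ _ := by gcongr

lemma SingleBigJump.mem_classS {F : HalfLineDist} (hF : F.SingleBigJump)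
    (hL : ∀ t : ℝ, 0 ≤ t → ∀ C : ℝ≥0∞, 1 < C →
      ∀ᶠ x in atTop, tail F.law (x - t) ≤ C * tail F.law x) : F ∈ classS := by
  refine tendsto_order.2 ⟨fun a ha => ?_, fun a ha => ?_⟩
  · have h : Tendsto (fun x => 1 + (1 - tail F.law x)) atTop (𝓝 (1 + (1 - 0))) :=
      tendsto_const_nhds.add
        (ENNReal.Tendsto.sub tendsto_const_nhds F.tendsto_tail (Or.inl ENNReal.one_ne_top))
    rw [tsub_zero, one_add_one_eq_two] at h
    filter_upwards [h.eventually_const_lt ha] with x hx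
    refine hx.trans_le ?_
    rw [ENNReal.le_div_iff_mul_le (Or.inl (F.tail_ne_zero x)) (Or.inl (F.tail_ne_top x)), add_mul,
      one_mul]
    exact le_self_add.trans (F.le_tail_conv (le_refl x))
  · obtain ⟨b, hb, hba⟩ := exists_between ha
    obtain ⟨d, hd, rfl⟩ : ∃ d, 0 < d ∧ b = 2 + d :=
      ⟨b - 2, tsub_pos_of_lt hb, (add_tsub_cancel_of_le hb.le).symm⟩
    have hd3 : 0 < d / 3 := ENNReal.div_pos hd.ne' (by finiteness)
    obtain ⟨K, hK0, hK⟩ := hF (d / 3) hd3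
    filter_upwards [hK, hL K hK0 (1 + d / 3) (ENNReal.lt_add_right (by simp) hd3.ne')]
      with x h1 h2
    refine lt_of_le_of_lt ?_ hba
    rw [ENNReal.div_le_iff (F.tail_ne_zero x) (F.tail_ne_top x)]
    calc _ ≤ _ := F.tail_conv_le K x
      _ ≤ 2 * ((1 + d / 3) * tail F.law x) + d / 3 * tail F.law x := by gcongr
      _ = (2 + 3 * (d / 3)) * tail F.law x := by ring
      _ = _ := by rw [ENNReal.mul_div_cancel (by norm_num) (by norm_num)]

/-! ### Distributions with a prescribed cumulative hazard. -/

/-- Cumulative hazard functions `g`, for which `x ↦ exp (-g x)` is the tail of a distribution with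
unbounded support in `[0, ∞)`. -/
structure IsHazard (g : ℝ → ℝ) : Prop where
  mono : Monotone g
  right_cont : ∀ x, ContinuousWithinAt g (Ici x) x
  of_nonpos : ∀ x ≤ 0, g x = 0
  tendsto : Tendsto g atTop atTop

namespace IsHazard

variable {g h : ℝ → ℝ}

lemma nonneg (hg : IsHazard g) (x : ℝ) : 0 ≤ g x := by
  rcases le_total x 0 with hx | hx
  · exact (hg.of_nonpos x hx).ge
  · rw [← hg.of_nonpos 0 le_rfl]; exact hg.mono hx

lemma floor (hg : IsHazard g) : IsHazard (fun x => (⌊g x⌋ : ℝ)) where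
  mono := fun x y hxy => Int.cast_le.2 (Int.floor_mono (hg.mono hxy))
  right_cont := fun x => by
    refine ContinuousWithinAt.congr_of_eventuallyEq (f := fun _ => (⌊g x⌋ : ℝ))
      continuousWithinAt_const ?_ rfl
    have h1 : ∀ᶠ y in 𝓝[≥] x, g y < ⌊g x⌋ + 1 :=
      (hg.right_cont x).eventually_lt_const (Int.lt_floor_add_one _)
    filter_upwards [h1, self_mem_nhdsWithin] with y hy hxy
    have : ⌊g y⌋ = ⌊g x⌋ :=
      Int.floor_eq_iff.2 ⟨(Int.floor_le _).trans (hg.mono hxy), hy⟩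
    exact_mod_cast this
  of_nonpos := fun x hx => by simp [hg.of_nonpos x hx]
  tendsto := tendsto_intCast_atTop_atTop.comp (tendsto_floor_atTop.comp hg.tendsto)

/-- The distribution function with cumulative hazard `g`. -/
noncomputable def cdf (hg : IsHazard g) : StieltjesFunction ℝ where
  toFun x := 1 - Real.exp (-g x)
  mono' := fun x y hxy => by
    have := Real.exp_le_exp.2 (neg_le_neg (hg.mono hxy))
    simp only; linarith
  right_continuous' := fun x =>
    continuousWithinAt_const.sub
      (Real.continuous_exp.continuousAt.comp_continuousWithinAt (hg.right_cont x).neg)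

lemma tendsto_cdf_atTop (hg : IsHazard g) : Tendsto hg.cdf atTop (𝓝 1) := by
  have := (Real.tendsto_exp_neg_atTop_nhds_zero.comp hg.tendsto).const_sub 1
  rwa [sub_zero] at this

lemma tendsto_cdf_atBot (hg : IsHazard g) : Tendsto hg.cdf atBot (𝓝 0) := by
  refine tendsto_const_nhds.congr' ?_
  filter_upwards [eventually_le_atBot 0] with x hx
  change 0 = 1 - Real.exp (-g x)
  simp [hg.of_nonpos x hx]

/-- The distribution with tail `x ↦ exp (-g x)`. -/
noncomputable def dist (hg : IsHazard g) : HalfLineDist where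
  law := hg.cdf.measure
  isProbabilityMeasure :=
    ⟨by rw [hg.cdf.measure_univ hg.tendsto_cdf_atBot hg.tendsto_cdf_atTop]; simp⟩
  law_Iio_zero := by
    refine measure_mono_null Iio_subset_Iic_self ?_
    rw [hg.cdf.measure_Iic hg.tendsto_cdf_atBot]
    change ENNReal.ofReal (1 - Real.exp (-g 0) - 0) = 0
    simp [hg.of_nonpos 0 le_rfl]
  law_Ioi_pos := fun x => by
    rw [hg.cdf.measure_Ioi hg.tendsto_cdf_atTop, ENNReal.ofReal_pos]
    change 0 < 1 - (1 - Real.exp (-g x))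
    simpa using Real.exp_pos _

lemma tail_dist (hg : IsHazard g) (x : ℝ) :
    tail hg.dist.law x = ENNReal.ofReal (Real.exp (-g x)) := by
  change hg.cdf.measure (Ioi x) = _
  rw [hg.cdf.measure_Ioi hg.tendsto_cdf_atTop]
  change ENNReal.ofReal (1 - (1 - Real.exp (-g x))) = _
  rw [sub_sub_cancel]

lemma tail_dist_le (hg : IsHazard g) {x y c : ℝ} (h : g y - g x ≤ c) :
    tail hg.dist.law x ≤ ENNReal.ofReal (Real.exp c) * tail hg.dist.law y := by
  rw [hg.tail_dist, hg.tail_dist, ← ENNReal.ofReal_mul (Real.exp_pos _).le, ← Real.exp_add]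
  exact ENNReal.ofReal_le_ofReal (Real.exp_le_exp.2 (by linarith))

lemma tail_dist_div (hg : IsHazard g) (hh : IsHazard h) (x y : ℝ) :
    tail hg.dist.law x / tail hh.dist.law y = ENNReal.ofReal (Real.exp (h y - g x)) := by
  rw [hg.tail_dist, hh.tail_dist, ← ENNReal.ofReal_div_of_pos (Real.exp_pos _), ← Real.exp_sub]
  congr 2; ring

/-- Since `g` may jump, its levels are located through the continuous `h`: if `h z = k - 1`, then `g
y ≥ k` forces `y > z`, and `g z ≥ k - 2`. -/
lemma law_level_le (hg : IsHazard g) (hh : Continuous h) (hh0 : h 0 = 0)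
    (hgh : ∀ x, g x ≤ h x) (hhg : ∀ x, h x ≤ g x + 1) (k : ℕ) :
    hg.dist.law {y | (k : ℝ) ≤ g y} ≤ ENNReal.ofReal (Real.exp (2 - k)) := by
  rcases k with _ | k
  · refine prob_le_one.trans ?_
    rw [ENNReal.one_le_ofReal]
    exact Real.one_le_exp (by simp)
  · have hT : Tendsto h atTop atTop := tendsto_atTop_mono hgh hg.tendsto
    obtain ⟨z, hz⟩ : ∃ z, h z = k := by
      obtain ⟨M, hM, hM0⟩ := ((hT.eventually_ge_atTop (k : ℝ)).and (eventually_ge_atTop 0)).exists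
      obtain ⟨z, -, hz⟩ := intermediate_value_Icc hM0 hh.continuousOn
        (show (k : ℝ) ∈ Icc (h 0) (h M) from ⟨by rw [hh0]; positivity, hM⟩)
      exact ⟨z, hz⟩
    calc _ ≤ tail hg.dist.law z := by
          refine measure_mono fun y hy => ?_
          simp only [mem_ofPred_eq, Nat.cast_add, Nat.cast_one] at hy
          by_contra hc
          have := hg.mono (not_lt.1 hc)
          linarith [hgh z]
      _ ≤ _ := by
          rw [hg.tail_dist]
          refine ENNReal.ofReal_le_ofReal (Real.exp_le_exp.2 ?_)
          push_cast
          linarith [hhg z]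

lemma lintegral_exp_ne_top (hg : IsHazard g) (hh : Continuous h) (hh0 : h 0 = 0)
    (hgh : ∀ x, g x ≤ h x) (hhg : ∀ x, h x ≤ g x + 1) :
    ∫⁻ y, ENNReal.ofReal (Real.exp (3 / 4 * g y)) ∂hg.dist.law ≠ ∞ := by
  have hm : Measurable g := hg.mono.measurable
  have hms : ∀ k : ℕ, MeasurableSet {y | (k : ℝ) ≤ g y} := fun k =>
    measurableSet_le measurable_const hm
  -- The `k`-th layer contributes at most `exp (3/4 * (k + 1)) * exp (2 - k) = exp (11/4 - k/4)`.
  have hs : Summable fun k : ℕ => Real.exp (11 / 4) * Real.exp (-(1 / 4)) ^ k :=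
    (summable_geometric_of_lt_one (Real.exp_pos _).le
      ((Real.exp_lt_exp.2 (by norm_num)).trans_eq Real.exp_zero)).mul_left _
  refine ne_top_of_le_ne_top hs.tsum_ofReal_ne_top ?_
  calc _ ≤ ∫⁻ y, ∑' k : ℕ, {y | (k : ℝ) ≤ g y}.indicator
          (fun _ => ENNReal.ofReal (Real.exp (3 / 4 * (k + 1)))) y ∂hg.dist.law := by
        refine lintegral_mono fun y => ?_
        refine le_trans ?_ (ENNReal.le_tsum ⌊g y⌋₊)
        have h1 : (⌊g y⌋₊ : ℝ) ≤ g y := Nat.floor_le (hg.nonneg y)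
        rw [indicator_of_mem (show y ∈ {z | (⌊g y⌋₊ : ℝ) ≤ g z} from h1)]
        refine ENNReal.ofReal_le_ofReal (Real.exp_le_exp.2 ?_)
        linarith [Nat.lt_floor_add_one (g y)]
    _ = ∑' k : ℕ, ENNReal.ofReal (Real.exp (3 / 4 * (k + 1))) *
          hg.dist.law {y | (k : ℝ) ≤ g y} := by
        rw [lintegral_tsum fun k => (measurable_const.indicator (hms k)).aemeasurable]
        exact tsum_congr fun k => lintegral_indicator_const (hms k) _
    _ ≤ _ := by
        refine ENNReal.tsum_le_tsum fun k => ?_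
        refine (mul_le_mul_right (hg.law_level_le hh hh0 hgh hhg k) _).trans_eq ?_
        rw [← ENNReal.ofReal_mul (Real.exp_pos _).le, ← Real.exp_nat_mul, ← Real.exp_add,
          ← Real.exp_add]
        congr 2; ring

/-- If one copy is `y ≤ x / 2`, the increment bound dominates the integrand by `exp (3/4 * g y + c)`
times the tail at `x`, and the integral over `y > K` is small. If both exceed `x / 2`, the bound at
`y = x / 2` leaves a factor `exp (c - g (x / 2) / 4)`. -/
lemma singleBigJump (hg : IsHazard g) (hh : Continuous h) (hh0 : h 0 = 0)
    (hgh : ∀ x, g x ≤ h x) (hhg : ∀ x, h x ≤ g x + 1) {c : ℝ}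
    (hc : ∀ x y, 0 ≤ y → 2 * y ≤ x → g x - g (x - y) ≤ 3 / 4 * g y + c) :
    hg.dist.SingleBigJump := by
  intro ε hε
  set F := hg.dist
  set I : ℝ → ℝ≥0∞ := fun K => ∫⁻ y in Ioi K, ENNReal.ofReal (Real.exp (3 / 4 * g y)) ∂F.law
  have hI : Tendsto (fun K => ENNReal.ofReal (Real.exp c) * I K) atTop (𝓝 0) := by
    rw [← mul_zero (ENNReal.ofReal (Real.exp c))]
    exact ENNReal.Tendsto.const_mul (tendsto_setLIntegral_zero
      (hg.lintegral_exp_ne_top hh hh0 hgh hhg) F.tendsto_tail) (Or.inr ENNReal.ofReal_ne_top)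
  have hε3 : 0 < ε / 3 := ENNReal.div_pos hε.ne' (by finiteness)
  obtain ⟨K, hK, hK0⟩ := ((hI.eventually_lt_const hε3).and (eventually_ge_atTop 0)).exists
  have hlast : Tendsto (fun x => ENNReal.ofReal (Real.exp (c - 1 / 4 * g (x / 2)))) atTop
      (𝓝 0) := by
    rw [← ENNReal.ofReal_zero]
    refine ENNReal.tendsto_ofReal (Real.tendsto_exp_atBot.comp ?_)
    exact tendsto_atBot_add_const_left _ c (tendsto_neg_atTop_atBot.comp
      ((hg.tendsto.comp (tendsto_id.atTop_div_const two_pos)).const_mul_atTop (by norm_num)))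
  refine ⟨K, hK0, ?_⟩
  filter_upwards [hlast.eventually_lt_const hε3, eventually_ge_atTop 0] with x hx hx0
  have hfirst : (F.law.prod F.law) {p | p.1 ∈ Ioc K (x / 2) ∧ x < p.1 + p.2} ≤
      ε / 3 * tail F.law x := by
    rw [prod_fst_mem_sum_gt _ measurableSet_Ioc]
    calc _ ≤ ∫⁻ y in Ioc K (x / 2), ENNReal.ofReal (Real.exp (3 / 4 * g y)) *
            (ENNReal.ofReal (Real.exp c) * tail F.law x) ∂F.law := by
          refine setLIntegral_mono' measurableSet_Ioc fun y hy => ?_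
          rw [← mul_assoc, ← ENNReal.ofReal_mul (Real.exp_pos _).le, ← Real.exp_add]
          exact hg.tail_dist_le (hc x y (by linarith [hy.1]) (by linarith [hy.2]))
      _ ≤ ∫⁻ y in Ioi K, ENNReal.ofReal (Real.exp (3 / 4 * g y)) *
            (ENNReal.ofReal (Real.exp c) * tail F.law x) ∂F.law :=
          lintegral_mono_set Ioc_subset_Ioi_self
      _ = ENNReal.ofReal (Real.exp c) * I K * tail F.law x := by
          rw [lintegral_mul_const' _ _ (ENNReal.mul_ne_top ENNReal.ofReal_ne_top (F.tail_ne_top x))]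
          ring
      _ ≤ _ := by gcongr
  have hsecond : (F.law.prod F.law) {p | p.2 ∈ Ioc K (x / 2) ∧ x < p.1 + p.2} ≤
      ε / 3 * tail F.law x := by
    refine le_trans (le_of_eq ?_) hfirst
    have hS : MeasurableSet {p : ℝ × ℝ | p.2 ∈ Ioc K (x / 2) ∧ x < p.1 + p.2} :=
      (measurable_snd measurableSet_Ioc).inter (measurableSet_sum_gt x)
    have : Prod.swap ⁻¹' {p : ℝ × ℝ | p.2 ∈ Ioc K (x / 2) ∧ x < p.1 + p.2} =
        {p | p.1 ∈ Ioc K (x / 2) ∧ x < p.1 + p.2} := by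
      ext p; simp [add_comm p.2]
    rw [← this, ← Measure.map_apply measurable_swap hS, Measure.prod_swap]
  have hthird : tail F.law (x / 2) * tail F.law (x / 2) ≤ ε / 3 * tail F.law x := by
    refine le_trans ?_ (mul_le_mul_left hx.le _)
    rw [hg.tail_dist, hg.tail_dist, ← ENNReal.ofReal_mul (Real.exp_pos _).le, ← Real.exp_add,
      ← ENNReal.ofReal_mul (Real.exp_pos _).le, ← Real.exp_add]
    refine ENNReal.ofReal_le_ofReal (Real.exp_le_exp.2 ?_)
    have := hc x (x / 2) (by linarith) (by linarith)
    rw [sub_half] at this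
    linarith
  calc F.jointExcess K x ≤ (F.law.prod F.law)
        (({p | p.1 ∈ Ioc K (x / 2) ∧ x < p.1 + p.2} ∪ {p | p.2 ∈ Ioc K (x / 2) ∧ x < p.1 + p.2}) ∪
          Ioi (x / 2) ×ˢ Ioi (x / 2)) := by
        refine measure_mono fun p hp => ?_
        obtain ⟨h1, h2, h3⟩ := hp
        by_cases h4 : p.1 ≤ x / 2
        · exact Or.inl (Or.inl ⟨⟨h1, h4⟩, h3⟩)
        · by_cases h5 : p.2 ≤ x / 2
          · exact Or.inl (Or.inr ⟨⟨h2, h5⟩, h3⟩)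
          · exact Or.inr ⟨not_le.1 h4, not_le.1 h5⟩
    _ ≤ (ε / 3 * tail F.law x + ε / 3 * tail F.law x) + ε / 3 * tail F.law x := by
        refine (measure_union_le _ _).trans (add_le_add ((measure_union_le _ _).trans
          (add_le_add hfirst hsecond)) ?_)
        rw [Measure.prod_prod]; exact hthird
    _ = 3 * (ε / 3) * tail F.law x := by ring
    _ = _ := by rw [ENNReal.mul_div_cancel (by norm_num) (by norm_num)]

/-! ### Class membership read off the hazard. -/

lemma dist_mem_classK (hg : IsHazard g) (h : ∀ x, 0 ≤ x → g x ≤ 2 * √x) : hg.dist ∈ classK := by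
  intro α hα
  have h1 : Tendsto (fun x : ℝ => ENNReal.ofReal (Real.exp (α / 2 * x - 2 / α))) atTop (𝓝 ∞) :=
    ENNReal.tendsto_ofReal_atTop.comp (Real.tendsto_exp_atTop.comp
      (tendsto_atTop_add_const_right _ _ (tendsto_id.const_mul_atTop (by positivity))))
  refine top_le_iff.1 (le_of_tendsto h1 ?_)
  filter_upwards [eventually_ge_atTop 0] with x hx
  calc _ ≤ ENNReal.ofReal (Real.exp (α * x)) * tail hg.dist.law x := by
        rw [hg.tail_dist, ← ENNReal.ofReal_mul (Real.exp_pos _).le, ← Real.exp_add]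
        refine ENNReal.ofReal_le_ofReal (Real.exp_le_exp.2 ?_)
        have h2 := h x hx
        -- Completing the square makes `√x` negligible against `α * x`.
        have h3 : 2 * √x ≤ α / 2 * x + 2 / α := by
          have h4 : α / 2 * x + 2 / α - 2 * √x = (α * √x - 2) ^ 2 / (2 * α) := by
            field_simp
            rw [← Real.sq_sqrt hx, Real.sqrt_sq (Real.sqrt_nonneg x)]
            ring
          have : 0 ≤ (α * √x - 2) ^ 2 / (2 * α) := by positivity
          linarith
        linarith
    _ = ∫⁻ _ in Ioi x, ENNReal.ofReal (Real.exp (α * x)) ∂hg.dist.law := by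
        rw [setLIntegral_const]; rfl
    _ ≤ ∫⁻ y in Ioi x, ENNReal.ofReal (Real.exp (α * y)) ∂hg.dist.law := by
        refine setLIntegral_mono' measurableSet_Ioi fun y hy => ?_
        have : x < y := hy
        gcongr
    _ ≤ _ := setLIntegral_le_lintegral _ _

lemma dist_notMem_classD (hg : IsHazard g)
    (h : ∀ m : ℕ, ∃ᶠ x in atTop, (m : ℝ) ≤ g x - g (x / 2)) : hg.dist ∉ classD := by
  intro hD
  obtain ⟨C, hC, hCt⟩ := exists_between (show limsup _ _ < ∞ from hD)
  lift C to NNReal using hCt.ne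
  have h1 := eventually_lt_of_limsup_lt hC
  obtain ⟨m, hm⟩ := exists_nat_ge (C : ℝ)
  obtain ⟨x, hx, hx2⟩ := ((h m).and_eventually h1).exists
  rw [hg.tail_dist_div hg, ENNReal.ofReal_lt_coe_iff (Real.exp_pos _).le] at hx2
  linarith [Real.add_one_le_exp (g x - g (x / 2))]

lemma dist_notMem_classL (hg : IsHazard g) {t δ : ℝ} (ht : 0 < t) (hδ : 0 < δ)
    (h : ∃ᶠ x in atTop, δ ≤ g x - g (x - t)) : hg.dist ∉ classL := by
  intro hL
  have h1 := (hL t ht).eventually_lt_const (u := ENNReal.ofReal (Real.exp δ)) (by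
    rw [ENNReal.one_lt_ofReal]; exact Real.one_lt_exp_iff.2 hδ)
  obtain ⟨x, hx, hx2⟩ := (h.and_eventually h1).exists
  rw [hg.tail_dist_div hg] at hx2
  exact hx2.not_ge (ENNReal.ofReal_le_ofReal (Real.exp_le_exp.2 hx))

lemma dist_notMem_weakS (hg : IsHazard g)
    (h : ∀ n : ℕ, ∃ t, ∃ᶠ x in atTop, (n : ℝ) ≤ g x - g (x - t)) : hg.dist ∉ weakS := by
  intro hS
  obtain ⟨C, hC, h1⟩ := exists_eventually_tail_sub_le_of_mem_weakS hS
  lift C to NNReal using hC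
  obtain ⟨n, hn⟩ := exists_nat_ge (C : ℝ)
  obtain ⟨t, ht⟩ := h n
  obtain ⟨x, hx, hx2⟩ := (ht.and_eventually (h1 t)).exists
  rw [← ENNReal.div_le_iff (tail_ne_zero _ _) (tail_ne_top _ _), hg.tail_dist_div hg,
    ENNReal.ofReal_le_iff_le_toReal ENNReal.coe_ne_top, ENNReal.coe_toReal] at hx2
  linarith [Real.add_one_le_exp (g x - g (x - t))]

lemma dist_mem_classS (hg : IsHazard g) (hJ : hg.dist.SingleBigJump)
    (h : ∀ t : ℝ, 0 ≤ t → ∀ δ : ℝ, 0 < δ → ∀ᶠ x in atTop, g x - g (x - t) ≤ δ) :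
    hg.dist ∈ classS := by
  refine hJ.mem_classS fun t ht C hC => ?_
  obtain ⟨c, hc1, hcC⟩ := exists_between hC
  lift c to NNReal using (hcC.trans_le le_top).ne
  have hc1' : (1 : ℝ) < c := by exact_mod_cast hc1
  filter_upwards [h t ht (Real.log c) (Real.log_pos hc1')] with x hx
  refine (hg.tail_dist_le hx).trans ?_
  rw [Real.exp_log (by linarith), ENNReal.ofReal_coe_nnreal]
  gcongr

lemma weakTailEquiv (hg : IsHazard g) (hh : IsHazard h) (hgh : ∀ x, g x ≤ h x)
    (hhg : ∀ x, h x ≤ g x + 1) : WeakTailEquiv hg.dist hh.dist := by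
  simp only [WeakTailEquiv, hg.tail_dist_div hh]
  constructor
  · refine one_pos.trans_le (le_liminf_of_le (by isBoundedDefault) (Eventually.of_forall fun x => ?_))
    rw [ENNReal.one_le_ofReal]
    exact Real.one_le_exp (by linarith [hgh x])
  · refine (limsup_le_of_le (a := ENNReal.ofReal (Real.exp 1)) (by isBoundedDefault)
      (Eventually.of_forall fun x => ?_)).trans_lt ENNReal.ofReal_lt_top
    exact ENNReal.ofReal_le_ofReal (Real.exp_le_exp.2 (by linarith [hhg x]))

lemma dist_mem_classDK₁ (hg : IsHazard g) (h : ∀ x, 0 ≤ x → g x ≤ 2 * Real.log (1 + x)) :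
    hg.dist ∈ classDK₁ := by
  -- The tail is at least `(1 + x)⁻²`, so any power above 2 would do.
  refine ⟨3, by norm_num, ?_⟩
  have h1 : Tendsto (fun x : ℝ => ENNReal.ofReal (x / 4)) atTop (𝓝 ∞) :=
    ENNReal.tendsto_ofReal_atTop.comp (tendsto_id.atTop_div_const (by norm_num))
  refine tendsto_of_tendsto_of_tendsto_of_le_of_le' h1 tendsto_const_nhds ?_
    (Eventually.of_forall fun _ => le_top)
  filter_upwards [eventually_ge_atTop 1] with x hx
  rw [hg.tail_dist, ← ENNReal.ofReal_mul (by positivity)]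
  refine ENNReal.ofReal_le_ofReal ?_
  have h2 : Real.exp (-(2 * Real.log (1 + x))) ≤ Real.exp (-g x) :=
    Real.exp_le_exp.2 (neg_le_neg (h x (by linarith)))
  have h3 : Real.exp (-(2 * Real.log (1 + x))) = ((1 + x) ^ 2)⁻¹ := by
    rw [Real.exp_neg, two_mul, Real.exp_add, Real.exp_log (by linarith), sq]
  have h4 : x / 4 ≤ x ^ 3 * ((1 + x) ^ 2)⁻¹ := by
    rw [← div_eq_mul_inv, div_le_div_iff₀ (by norm_num) (by positivity)]
    nlinarith [mul_nonneg (by linarith : 0 ≤ x) (by nlinarith : 0 ≤ 4 * x ^ 2 - (1 + x) ^ 2)]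
  have h5 : x ^ (3 : ℝ) = x ^ 3 := by exact_mod_cast Real.rpow_natCast x 3
  rw [h5]
  refine h4.trans ?_
  rw [← h3]
  gcongr

lemma dist_notMem_classDK₁ (hg : IsHazard g) (h : ∀ x, √x ≤ g x + 1) :
    hg.dist ∉ classDK₁ := by
  rintro ⟨δ, hδ, hT⟩
  have h1 : Tendsto (fun x : ℝ => Real.exp 1 * (√x ^ (2 * δ) * Real.exp (-1 * √x))) atTop
      (𝓝 (Real.exp 1 * 0)) :=
    ((tendsto_rpow_mul_exp_neg_mul_atTop_nhds_zero _ 1 one_pos).comp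
      Real.tendsto_sqrt_atTop).const_mul _
  rw [mul_zero] at h1
  have h2 := h1.eventually_lt_const one_pos
  have h3 := hT.eventually_const_lt ENNReal.one_lt_top
  obtain ⟨x, ⟨hx2, hx3⟩, hx⟩ := ((h2.and h3).and (eventually_ge_atTop 0)).exists
  rw [hg.tail_dist, ← ENNReal.ofReal_mul (by positivity), ENNReal.one_lt_ofReal] at hx3
  have h4 : √x ^ (2 * δ) = x ^ δ := by
    rw [Real.rpow_mul (Real.sqrt_nonneg x)]
    congr 1; exact_mod_cast Real.sq_sqrt hx
  rw [h4, mul_left_comm, ← Real.exp_add] at hx2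
  have h5 : Real.exp (-g x) ≤ Real.exp (1 + -1 * √x) := Real.exp_le_exp.2 (by linarith [h x])
  have := mul_le_mul_of_nonneg_left h5 (by positivity : 0 ≤ x ^ δ)
  linarith

end IsHazard

namespace IsHazard

/-- Otherwise the floor would not increase along `a + n`, contradicting divergence of `h`. -/
lemma frequently_floor_sub {h : ℝ → ℝ} (hh : IsHazard h) :
    ∃ᶠ x in atTop, (1 : ℝ) ≤ ⌊h x⌋ - ⌊h (x - 1)⌋ := by
  intro hc
  obtain ⟨a, ha⟩ := eventually_atTop.1 hc
  have hstep : ∀ n : ℕ, ⌊h (a + n)⌋ ≤ ⌊h a⌋ := by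
    intro n
    induction n with
    | zero => simp
    | succ n ih =>
      refine le_trans ?_ ih
      have h1 := ha (a + (n + 1 : ℕ)) (by simp; positivity)
      have h2 : a + ((n + 1 : ℕ) : ℝ) - 1 = a + n := by push_cast; ring
      simp only [h2] at h1
      by_contra! h3
      refine h1 ?_
      have : ((⌊h (a + n)⌋ + 1 : ℤ) : ℝ) ≤ ⌊h (a + (n + 1 : ℕ))⌋ := Int.cast_le.2 h3
      push_cast at this ⊢
      linarith
  have hT : Tendsto (fun n : ℕ => h (a + n)) atTop atTop :=
    hh.tendsto.comp (tendsto_atTop_add_const_left _ a tendsto_natCast_atTop_atTop)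
  obtain ⟨n, hn⟩ := (hT.eventually_ge_atTop ((⌊h a⌋ : ℝ) + 1)).exists
  have := Int.lt_floor_add_one (h (a + n))
  have h2 : (⌊h (a + n)⌋ : ℝ) ≤ ⌊h a⌋ := Int.cast_le.2 (hstep n)
  linarith

end IsHazard

/-! ### Sparse logarithmic ramps. -/

/-- The location of the `m`-th region of fast decay of the tails below. -/
noncomputable def start (m : ℕ) : ℝ := Real.exp (8 * 2 ^ m)

lemma start_pos (m : ℕ) : 0 < start m := Real.exp_pos _

lemma natCast_le_two_pow (m : ℕ) : (m : ℝ) ≤ 2 ^ m := by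
  exact_mod_cast Nat.lt_two_pow_self.le

lemma natCast_le_start (m : ℕ) : (m : ℝ) ≤ start m := by
  have h1 := natCast_le_two_pow m
  have h2 := Real.add_one_le_exp (8 * 2 ^ m : ℝ)
  have h3 : (0 : ℝ) < 2 ^ m := by positivity
  unfold start; linarith

/-- Each start is the square of the previous one. The factor 4 ensures that no interval `[z, 2z]`
meets two ramps. -/
lemma four_mul_start_le (m : ℕ) : 4 * start m ≤ start (m + 1) := by
  have h1 : start (m + 1) = start m * start m := by
    rw [start, start, ← Real.exp_add]; congr 1; ring
  have h2 := Real.add_one_le_exp (8 * 2 ^ m : ℝ)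
  have h3 : (1 : ℝ) ≤ 2 ^ m := one_le_pow₀ (by norm_num)
  rw [h1]
  exact mul_le_mul_of_nonneg_right (by unfold start; linarith) (start_pos m).le

lemma start_mono : Monotone start :=
  monotone_nat_of_le_succ fun m => by linarith [four_mul_start_le m, start_pos m]

/-- The right side is `log (start n)`: it dominates the total height of the ramps begun by then. -/
lemma sum_range_le_two_pow (n : ℕ) : ∑ m ∈ Finset.range (n + 1), (m : ℝ) ≤ 8 * 2 ^ n := by
  induction n with
  | zero => simp
  | succ n ih =>
    rw [Finset.sum_range_succ, pow_succ]
    have h1 := natCast_le_two_pow n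
    have h2 : (1 : ℝ) ≤ 2 ^ n := one_le_pow₀ (by norm_num)
    push_cast
    linarith

/-- A hazard that rises logarithmically, at scale `w m`, from `0` to `m` to the right of
`start m`. -/
noncomputable def ramp (w : ℕ → ℝ) (m : ℕ) (x : ℝ) : ℝ :=
  min (m : ℝ) (1 / 4 * Real.log (1 + max (x - start m) 0 / w m))

/-- The sum of all ramps; those missing from the range vanish. -/
noncomputable def rampSum (w : ℕ → ℝ) (x : ℝ) : ℝ :=
  ∑ m ∈ Finset.range ⌈x⌉₊, ramp w m x

/-- Admissible sequences of scales. -/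
structure IsScale (w : ℕ → ℝ) : Prop where
  one_le : ∀ m, 1 ≤ w m
  le_add_one : ∀ m, w m ≤ m + 1

lemma isScale_one : IsScale fun _ => 1 where
  one_le _ := le_rfl
  le_add_one m := by simp

lemma isScale_add_one : IsScale fun m => m + 1 where
  one_le m := by simp
  le_add_one _ := le_rfl

section ramp

variable {w : ℕ → ℝ} (hw : IsScale w)
include hw

lemma ramp_arg_nonneg (m : ℕ) (x : ℝ) : 0 ≤ max (x - start m) 0 / w m :=
  div_nonneg (le_max_right _ _) (zero_le_one.trans (hw.one_le m))

lemma ramp_mono (m : ℕ) : Monotone (ramp w m) := fun x y hxy => by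
  have := ramp_arg_nonneg hw m x
  have := hw.one_le m
  unfold ramp
  gcongr

lemma ramp_nonneg (m : ℕ) (x : ℝ) : 0 ≤ ramp w m x :=
  le_min (Nat.cast_nonneg m)
    (mul_nonneg (by norm_num) (Real.log_nonneg (by linarith [ramp_arg_nonneg hw m x])))

lemma continuous_ramp (m : ℕ) : Continuous (ramp w m) :=
  continuous_const.min (continuous_const.mul (Continuous.log (by fun_prop)
    fun x => by linarith [ramp_arg_nonneg hw m x]))

omit hw in
lemma ramp_le (m : ℕ) (x : ℝ) : ramp w m x ≤ m := min_le_left _ _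

omit hw in
lemma ramp_eq_zero {m : ℕ} {x : ℝ} (hx : x ≤ start m) : ramp w m x = 0 := by
  simp [ramp, max_eq_right (sub_nonpos.2 hx)]

/-- Within distance `w m * exp (4 * m)` of its start a ramp has reached full height, hence by `2 *
start m`. -/
lemma scale_mul_exp_le (m : ℕ) : w m * Real.exp (4 * m) ≤ start m := by
  calc w m * Real.exp (4 * m) ≤ Real.exp m * Real.exp (4 * m) := by
        gcongr; exact (hw.le_add_one m).trans (Real.add_one_le_exp _)
    _ = Real.exp (5 * m) := by rw [← Real.exp_add]; congr 1; ring
    _ ≤ start m := Real.exp_le_exp.2 (by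
        linarith [natCast_le_two_pow m, (Nat.cast_nonneg m : (0 : ℝ) ≤ m)])

lemma ramp_eq {m : ℕ} {x : ℝ} (hx : 2 * start m ≤ x) : ramp w m x = m := by
  refine min_eq_left ?_
  have h0 : 0 < w m := zero_lt_one.trans_le (hw.one_le m)
  have h1 : Real.exp (4 * m) ≤ max (x - start m) 0 / w m := by
    rw [le_div_iff₀' h0]
    exact (scale_mul_exp_le hw m).trans (le_max_of_le_left (by linarith))
  have h2 : 4 * (m : ℝ) ≤ Real.log (1 + max (x - start m) 0 / w m) := by
    rw [Real.le_log_iff_exp_le (by linarith [Real.exp_pos (4 * m)])]; linarith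
  linarith

/-- Logarithmic subadditivity, from `1 + b + d ≤ (1 + b) * (1 + d)`; truncation at `m` only shrinks
increments. -/
lemma ramp_sub_le (m : ℕ) {z x : ℝ} (hzx : z ≤ x) :
    ramp w m x - ramp w m z ≤ 1 / 4 * Real.log (1 + (x - z) / w m) := by
  have h0 : 0 < w m := zero_lt_one.trans_le (hw.one_le m)
  set a := max (x - start m) 0 / w m with ha
  set b := max (z - start m) 0 / w m with hb
  set d := (x - z) / w m with hd
  have hb0 : 0 ≤ b := ramp_arg_nonneg hw m z
  have hd0 : 0 ≤ d := div_nonneg (sub_nonneg.2 hzx) h0.le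
  have hab : a ≤ b + d := by
    rw [ha, hb, hd, ← add_div]
    gcongr
    exact max_le (by linarith [le_max_left (z - start m) 0])
      (by linarith [le_max_right (z - start m) 0])
  have hlog : Real.log (1 + a) ≤ Real.log (1 + b) + Real.log (1 + d) := by
    rw [← Real.log_mul (by linarith) (by linarith)]
    refine Real.log_le_log (by linarith [ramp_arg_nonneg hw m x]) ?_
    nlinarith [mul_nonneg hb0 hd0]
  have hd1 : 0 ≤ Real.log (1 + d) := Real.log_nonneg (by linarith)
  unfold ramp
  rw [← ha, ← hb]
  rcases le_total (m : ℝ) (1 / 4 * Real.log (1 + b)) with h | h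
  · rw [min_eq_left h]
    linarith [min_le_left (m : ℝ) (1 / 4 * Real.log (1 + a))]
  · rw [min_eq_right h]
    linarith [min_le_right (m : ℝ) (1 / 4 * Real.log (1 + a))]

omit hw in
lemma rampSum_eq {x : ℝ} {N : ℕ} (hN : x ≤ N) :
    rampSum w x = ∑ m ∈ Finset.range N, ramp w m x := by
  refine Finset.sum_subset (Finset.range_subset_range.2 (Nat.ceil_le.2 hN)) fun m _ hm => ?_
  rw [Finset.mem_range, not_lt] at hm
  exact ramp_eq_zero ((Nat.ceil_le.1 hm).trans (natCast_le_start m))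

omit hw in
lemma rampSum_sub_eq {z x : ℝ} {N : ℕ} (hzx : z ≤ x) (hN : x ≤ N) :
    rampSum w x - rampSum w z = ∑ m ∈ Finset.range N, (ramp w m x - ramp w m z) := by
  rw [rampSum_eq hN, rampSum_eq (hzx.trans hN), Finset.sum_sub_distrib]

lemma ramp_sub_le_rampSum_sub (m : ℕ) {z x : ℝ} (hzx : z ≤ x) :
    ramp w m x - ramp w m z ≤ rampSum w x - rampSum w z := by
  obtain ⟨N, hN⟩ := exists_nat_ge x
  have hN' : x ≤ (max N (m + 1) : ℕ) := hN.trans (Nat.cast_le.2 (le_max_left _ _))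
  rw [rampSum_sub_eq hzx hN']
  exact Finset.single_le_sum (f := fun m => ramp w m x - ramp w m z)
    (fun i _ => sub_nonneg.2 (ramp_mono hw i hzx))
    (Finset.mem_range.2 (lt_of_lt_of_le (Nat.lt_succ_self m) (le_max_right _ _)))

lemma rampSum_mono : Monotone (rampSum w) := fun z x hzx => by
  have := ramp_sub_le_rampSum_sub hw 0 hzx
  have := ramp_mono hw 0 hzx
  linarith

lemma rampSum_nonneg (x : ℝ) : 0 ≤ rampSum w x := Finset.sum_nonneg fun m _ => ramp_nonneg hw m x

omit hw in
lemma rampSum_of_nonpos {x : ℝ} (hx : x ≤ 0) : rampSum w x = 0 := by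
  simp [rampSum, Nat.ceil_eq_zero.2 hx]

lemma continuous_rampSum : Continuous (rampSum w) := by
  refine continuous_iff_continuousAt.2 fun x => ?_
  obtain ⟨N, hN⟩ := exists_nat_gt x
  have h1 : (fun y => ∑ m ∈ Finset.range N, ramp w m y) =ᶠ[𝓝 x] rampSum w := by
    filter_upwards [eventually_lt_nhds hN] with y hy
    exact (rampSum_eq hy.le).symm
  exact (continuous_finsetSum _ fun m _ => continuous_ramp hw m).continuousAt.congr h1

omit hw in
lemma rampSum_le_log {x : ℝ} (hx : 0 ≤ x) : rampSum w x ≤ Real.log (1 + x) := by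
  unfold rampSum
  induction ⌈x⌉₊ with
  | zero => simpa using Real.log_nonneg (by linarith)
  | succ N ih =>
    rcases le_total x (start N) with h | h
    · rwa [Finset.sum_range_succ, ramp_eq_zero h, add_zero]
    · calc _ ≤ ∑ m ∈ Finset.range (N + 1), (m : ℝ) := Finset.sum_le_sum fun m _ => ramp_le m x
        _ ≤ 8 * 2 ^ N := sum_range_le_two_pow N
        _ ≤ Real.log (1 + x) := by
          rw [Real.le_log_iff_exp_le (by linarith)]
          exact h.trans (by linarith)

/-- At most one ramp contributes to the increment between `z` and `x ≤ 2 * z`. -/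
lemma rampSum_sub_cases {z x : ℝ} (hzx : z ≤ x) (hxz : x ≤ 2 * z) :
    rampSum w x = rampSum w z ∨
      ∃ m, z < 2 * start m ∧ rampSum w x - rampSum w z = ramp w m x - ramp w m z := by
  obtain ⟨N, hN⟩ := exists_nat_ge x
  -- A ramp is constant outside `(start m, 2 * start m)`, so it changes only if this interval meets
  -- `(z, x)`.
  have active : ∀ m, ramp w m x - ramp w m z ≠ 0 → start m < x ∧ z < 2 * start m := by
    refine fun m hm => ⟨?_, ?_⟩ <;> by_contra! hc <;> apply hm
    · rw [ramp_eq_zero hc, ramp_eq_zero (hzx.trans hc), sub_zero]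
    · rw [ramp_eq hw hc, ramp_eq hw (hc.trans hzx), sub_self]
  have excl : ∀ m k, m < k → start k < x → z < 2 * start m → False := by
    intro m k hmk h1 h2
    linarith [four_mul_start_le m, start_mono (Nat.succ_le_of_lt hmk)]
  by_cases hall : ∀ m ∈ Finset.range N, ramp w m x - ramp w m z = 0
  · left
    have := rampSum_sub_eq (w := w) hzx hN
    rw [Finset.sum_eq_zero hall] at this
    linarith
  · right
    push Not at hall
    obtain ⟨m, hmN, hm⟩ := hall
    refine ⟨m, (active m hm).2, ?_⟩
    rw [rampSum_sub_eq hzx hN]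
    refine Finset.sum_eq_single_of_mem m hmN fun k _ hk => ?_
    by_contra hk0
    rcases lt_or_gt_of_ne hk with h | h
    · exact excl k m h (active m hm).1 (active k hk0).2
    · exact excl m k h (active k hk0).1 (active m hm).2

lemma rampSum_sub_le {x y : ℝ} (hy : 0 ≤ y) (hxy : 2 * y ≤ x) :
    rampSum w x - rampSum w (x - y) ≤ 1 / 4 * Real.log (1 + y) := by
  have hl : 0 ≤ Real.log (1 + y) := Real.log_nonneg (by linarith)
  rcases rampSum_sub_cases hw (by linarith : x - y ≤ x) (by linarith) with h | ⟨m, -, h⟩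
  · linarith
  · have h1 := ramp_sub_le hw m (by linarith : x - y ≤ x)
    rw [h]
    refine h1.trans ?_
    rw [sub_sub_cancel]
    have h2 := hw.one_le m
    have : 0 ≤ y / w m := div_nonneg hy (by linarith)
    gcongr
    exact div_le_self hy h2

end ramp

/-- Far out, the only ramp meeting the window has large index `m`, and its slope is at most `1 / (4
* (m + 1))`. -/
lemma eventually_rampSum_sub_le {t δ : ℝ} (ht : 0 ≤ t) (hδ : 0 < δ) :
    ∀ᶠ x in atTop,
      rampSum (fun m => m + 1) x - rampSum (fun m => m + 1) (x - t) ≤ δ := by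
  obtain ⟨M, hM⟩ := exists_nat_ge (t / δ)
  filter_upwards [eventually_ge_atTop (2 * t), eventually_ge_atTop (2 * start M + t)]
    with x hx1 hx2
  rcases rampSum_sub_cases isScale_add_one (by linarith : x - t ≤ x) (by linarith) with
    h | ⟨m, hm, h⟩
  · linarith
  · have hMm : M ≤ m := by
      by_contra! hc
      linarith [start_mono hc.le]
    have hMm' : (M : ℝ) ≤ m := Nat.cast_le.2 hMm
    have hm0 : (0 : ℝ) < m + 1 := by positivity
    have h1 := ramp_sub_le isScale_add_one m (by linarith : x - t ≤ x)
    have h2 : 0 ≤ t / (m + 1) := by positivity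
    have h3 := Real.log_le_sub_one_of_pos (by linarith : 0 < 1 + t / (m + 1))
    have h4 : t / (m + 1) ≤ δ := by
      rw [div_le_iff₀ hm0, ← div_le_iff₀' hδ]; linarith
    rw [sub_sub_cancel] at h1
    linarith

/-! ### The two base hazards. -/

/-- The slowly increasing part of the hazards below. -/
structure IsBase (B : ℝ → ℝ) : Prop where
  continuous : Continuous B
  mono : Monotone B
  of_nonpos : ∀ x ≤ 0, B x = 0
  log_le : ∀ x, 0 ≤ x → Real.log (1 + x) ≤ B x
  le_sqrt : ∀ x, 0 ≤ x → B x ≤ √x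
  sub_le : ∀ x y, 0 ≤ y → 2 * y ≤ x → B x - B (x - y) ≤ 1 / 2 * B y + 1
  eventually_sub_le : ∀ t : ℝ, 0 ≤ t → ∀ δ : ℝ, 0 < δ → ∀ᶠ x in atTop, B x - B (x - t) ≤ δ

lemma log_one_add_le_sqrt {x : ℝ} (hx : 0 ≤ x) : Real.log (1 + x) ≤ √x := by
  rw [Real.log_le_iff_le_exp (by linarith)]
  -- With `s = √x`, the cubic Taylor polynomial of `exp s` exceeds `1 + s ^ 2` because `s ^ 2 - 3 *
  -- s + 6 > 0`.
  have h1 := Real.sum_le_exp_of_nonneg (Real.sqrt_nonneg x) 4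
  simp only [Finset.sum_range_succ, Finset.sum_range_zero, Nat.factorial] at h1
  norm_num at h1
  have h2 := Real.sq_sqrt hx
  have h3 := Real.sqrt_nonneg x
  nlinarith [mul_nonneg h3 (sq_nonneg (√x - 3 / 2))]

lemma isBase_log : IsBase fun x => Real.log (1 + max x 0) where
  continuous := Continuous.log (by fun_prop) fun x => by linarith [le_max_right x 0]
  mono := fun x y hxy => by
    have := le_max_right x 0
    simp only
    gcongr
  of_nonpos x hx := by simp [max_eq_right hx]
  log_le x hx := by rw [max_eq_left hx]
  le_sqrt x hx := by rw [max_eq_left hx]; exact log_one_add_le_sqrt hx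
  sub_le x y hy hxy := by
    rw [max_eq_left (by linarith), max_eq_left (by linarith), max_eq_left hy]
    have h1 : Real.log (1 + x) ≤ Real.log (2 * (1 + (x - y))) :=
      Real.log_le_log (by linarith) (by linarith)
    rw [Real.log_mul (by norm_num) (by linarith)] at h1
    have h2 := Real.log_le_sub_one_of_pos (two_pos : (0 : ℝ) < 2)
    have h3 : 0 ≤ Real.log (1 + y) := Real.log_nonneg (by linarith)
    linarith
  eventually_sub_le t ht δ hδ := by
    filter_upwards [eventually_ge_atTop (t + t / δ)] with x hx
    have h0 : 0 ≤ t / δ := by positivity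
    rw [max_eq_left (by linarith), max_eq_left (by linarith),
      ← Real.log_div (by linarith) (by linarith)]
    have hp : 0 < 1 + (x - t) := by linarith
    refine (Real.log_le_sub_one_of_pos (div_pos (by linarith) hp)).trans ?_
    rw [div_sub_one hp.ne', div_le_iff₀ hp]
    have : t = δ * (t / δ) := by field_simp
    nlinarith [mul_le_mul_of_nonneg_left (by linarith : t / δ ≤ x - t) hδ.le]

lemma isBase_sqrt : IsBase Real.sqrt where
  continuous := Real.continuous_sqrt
  mono := fun _ _ hxy => Real.sqrt_le_sqrt hxy
  of_nonpos _ hx := Real.sqrt_eq_zero_of_nonpos hx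
  log_le _ hx := log_one_add_le_sqrt hx
  le_sqrt _ _ := le_rfl
  sub_le x y hy hxy := by
    have h1 := Real.sq_sqrt (by linarith : 0 ≤ x)
    have h2 := Real.sq_sqrt (by linarith : 0 ≤ x - y)
    have h3 := Real.sq_sqrt hy
    -- Hence `√x - √(x - y) = y / (√x + √(x - y))` is at most `√y / 2`.
    have h4 : √y ≤ √(x - y) := Real.sqrt_le_sqrt (by linarith)
    have h5 := Real.sqrt_nonneg y
    by_contra! hc
    nlinarith
  eventually_sub_le t ht δ hδ := by
    filter_upwards [eventually_ge_atTop t, eventually_ge_atTop ((t / δ) ^ 2)] with x hx1 hx2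
    have h1 := Real.sq_sqrt (by linarith : 0 ≤ x)
    have h2 := Real.sq_sqrt (by linarith : 0 ≤ x - t)
    have h3 : t / δ ≤ √x := Real.le_sqrt_of_sq_le hx2
    rw [div_le_iff₀' hδ] at h3
    have h4 := Real.sqrt_nonneg (x - t)
    have h5 := Real.sqrt_nonneg x
    by_contra! hc
    nlinarith

/-! ### The combined hazard and its perturbations by at most 1. -/

/-- The cumulative hazard obtained by adding the ramps at scale `w` to the base `B`. -/
noncomputable def hazard (B : ℝ → ℝ) (w : ℕ → ℝ) (x : ℝ) : ℝ := B x + rampSum w x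

section hazard

variable {B : ℝ → ℝ} {w : ℕ → ℝ} (hB : IsBase B) (hw : IsScale w)
include hB hw

lemma continuous_hazard : Continuous (hazard B w) := hB.continuous.add (continuous_rampSum hw)

lemma isHazard_hazard : IsHazard (hazard B w) where
  mono := hB.mono.add (rampSum_mono hw)
  right_cont _ := (continuous_hazard hB hw).continuousWithinAt
  of_nonpos x hx := by rw [hazard, hB.of_nonpos x hx, rampSum_of_nonpos hx, add_zero]
  tendsto := by
    have h1 : Tendsto (fun x : ℝ => Real.log (1 + x)) atTop atTop :=
      Real.tendsto_log_atTop.comp (tendsto_atTop_add_const_left _ 1 tendsto_id)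
    refine tendsto_atTop_mono' _ ?_ h1
    filter_upwards [eventually_ge_atTop 0] with x hx
    exact (hB.log_le x hx).trans (le_add_of_nonneg_right (rampSum_nonneg hw x))

/-- The base contributes `1/2 * B y + 1` and the ramps `1/4 * log (1 + y) ≤ 1/4 * B y`. -/
lemma hazard_sub_le {x y : ℝ} (hy : 0 ≤ y) (hxy : 2 * y ≤ x) :
    hazard B w x - hazard B w (x - y) ≤ 3 / 4 * hazard B w y + 1 := by
  have h1 := hB.sub_le x y hy hxy
  have h2 := rampSum_sub_le hw hy hxy
  have h3 := hB.log_le y hy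
  have h4 := rampSum_nonneg hw y
  unfold hazard
  linarith

lemma ramp_sub_le_hazard_sub (m : ℕ) {z x : ℝ} (hzx : z ≤ x) :
    ramp w m x - ramp w m z ≤ hazard B w x - hazard B w z := by
  have := ramp_sub_le_rampSum_sub hw m hzx
  have := hB.mono hzx
  unfold hazard
  linarith

omit hw in
lemma hazard_le {x : ℝ} (hx : 0 ≤ x) : hazard B w x ≤ 2 * B x := by
  have := rampSum_le_log (w := w) hx
  have := hB.log_le x hx
  unfold hazard
  linarith

variable {g : ℝ → ℝ} (hg : IsHazard g) (hgh : ∀ x, g x ≤ hazard B w x)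
  (hhg : ∀ x, hazard B w x ≤ g x + 1)
include hgh hhg

lemma singleBigJump_of_near_hazard : hg.dist.SingleBigJump := by
  refine hg.singleBigJump (continuous_hazard hB hw)
    -- Replacing the hazard by `g` costs 1 at `x - y` and `3/4` at `y`, so `1 + 1 + 3/4 ≤ 3`.
    ((isHazard_hazard hB hw).of_nonpos 0 le_rfl) hgh hhg (c := 3) fun x y hy hxy => ?_
  have h1 := hazard_sub_le hB hw hy hxy
  linarith [hgh x, hhg (x - y), hhg y]

lemma notMem_classD_of_near_hazard : hg.dist ∉ classD := by
  refine hg.dist_notMem_classD fun m => frequently_atTop.2 fun a => ?_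
  -- Doubling `start k` gains a full ramp of height `k`; the extra 1 absorbs the distance from `g`
  -- to the hazard.
  obtain ⟨k, hk⟩ := exists_nat_ge (max a (m + 1))
  have hka := (le_max_left _ _).trans hk
  have hkm := (le_max_right _ _).trans hk
  have h0 := start_pos k
  refine ⟨2 * start k, by linarith [natCast_le_start k], ?_⟩
  rw [mul_div_cancel_left₀ _ two_ne_zero]
  have h1 := ramp_sub_le_hazard_sub hB hw k (by linarith : start k ≤ 2 * start k)
  rw [ramp_eq hw le_rfl, ramp_eq_zero le_rfl] at h1
  linarith [hhg (2 * start k), hgh (start k)]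

lemma mem_diff_classD_of_near_hazard (hL : hg.dist ∉ classL) :
    hg.dist ∈ (classJ ∩ classK) \ (classL ∪ classD) := by
  refine ⟨⟨(singleBigJump_of_near_hazard hB hw hg hgh hhg).mem_classJ,
    hg.dist_mem_classK fun x hx => ?_⟩,
    not_or.2 ⟨hL, notMem_classD_of_near_hazard hB hw hg hgh hhg⟩⟩
  have h1 := hazard_le (w := w) hB hx
  linarith [hgh x, hB.le_sqrt x hx]

end hazard

/-! ### The examples. -/

/-- The witness is the floored hazard at scale `m + 1`; the unfloored one supplies the
subexponential partner. -/
lemma exists_mem_weakS {B : ℝ → ℝ} (hB : IsBase B) : ∃ g, ∃ hg : IsHazard g,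
    (∀ x, g x ≤ hazard B (fun m => m + 1) x) ∧ (∀ x, hazard B (fun m => m + 1) x ≤ g x + 1) ∧
      hg.dist ∈ (classJ ∩ classK) \ (classL ∪ classD) ∧ hg.dist ∈ weakS := by
  have hw := isScale_add_one
  have hh := isHazard_hazard hB hw
  have hgh : ∀ x, (⌊hazard B (fun m => m + 1) x⌋ : ℝ) ≤ hazard B (fun m => m + 1) x :=
    fun x => Int.floor_le _
  have hhg : ∀ x, hazard B (fun m => m + 1) x ≤ ⌊hazard B (fun m => m + 1) x⌋ + 1 :=
    fun x => (Int.lt_floor_add_one _).le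
  refine ⟨_, hh.floor, hgh, hhg, mem_diff_classD_of_near_hazard hB hw hh.floor hgh hhg
    (hh.floor.dist_notMem_classL one_pos one_pos hh.frequently_floor_sub), hh.dist, ?_,
    hh.floor.weakTailEquiv hh hgh hhg⟩
  refine hh.dist_mem_classS (singleBigJump_of_near_hazard hB hw hh (fun _ => le_rfl)
    fun x => by linarith) fun t ht δ hδ => ?_
  filter_upwards [hB.eventually_sub_le t ht _ (half_pos hδ),
    eventually_rampSum_sub_le ht (half_pos hδ)] with x h1 h2
  unfold hazard
  linarith

/-- No floor is needed at scale 1: for every `k ≥ n`, the first stretch of length `exp (4 * n)` of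
the `k`-th ramp already climbs by `n`. -/
lemma exists_notMem_weakS {B : ℝ → ℝ} (hB : IsBase B) : ∃ g, ∃ hg : IsHazard g,
    (∀ x, g x ≤ hazard B (fun _ => 1) x) ∧ (∀ x, hazard B (fun _ => 1) x ≤ g x + 1) ∧
      hg.dist ∈ (classJ ∩ classK) \ (classL ∪ classD) ∧ hg.dist ∉ weakS := by
  have hw := isScale_one
  have hh := isHazard_hazard hB hw
  have hfreq : ∀ n : ℕ, ∃ᶠ x in atTop,
      (n : ℝ) ≤ hazard B (fun _ => 1) x - hazard B (fun _ => 1) (x - Real.exp (4 * n)) := by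
    refine fun n => frequently_atTop.2 fun a => ?_
    obtain ⟨k, hk⟩ := exists_nat_ge (max a n)
    have hka := (le_max_left _ _).trans hk
    have hkn := (le_max_right _ _).trans hk
    have h0 := Real.exp_pos (4 * n)
    refine ⟨start k + Real.exp (4 * n), by linarith [natCast_le_start k], ?_⟩
    rw [add_sub_cancel_right]
    refine le_trans ?_ (ramp_sub_le_hazard_sub hB hw k (by linarith))
    rw [ramp_eq_zero le_rfl, sub_zero]
    refine le_min hkn ?_
    rw [add_sub_cancel_left, max_eq_left h0.le, div_one]
    have : 4 * (n : ℝ) ≤ Real.log (1 + Real.exp (4 * n)) := by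
      rw [Real.le_log_iff_exp_le (by linarith)]; linarith
    linarith
  have hgh : ∀ x, hazard B (fun _ => 1) x ≤ hazard B (fun _ => 1) x + 1 := fun x => by linarith
  exact ⟨_, hh, fun _ => le_rfl, hgh,
    mem_diff_classD_of_near_hazard hB hw hh (fun _ => le_rfl) hgh
      (hh.dist_notMem_classL (Real.exp_pos _) one_pos (by simpa using hfreq 1)),
    hh.dist_notMem_weakS fun n => ⟨_, hfreq n⟩⟩

lemma mem_classDK₁_of_le_hazard_log {g : ℝ → ℝ} (hg : IsHazard g) {w : ℕ → ℝ}
    (hgh : ∀ x, g x ≤ hazard (fun x => Real.log (1 + max x 0)) w x) : hg.dist ∈ classDK₁ := by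
  refine hg.dist_mem_classDK₁ fun x hx => (hgh x).trans ?_
  have := hazard_le (w := w) isBase_log hx
  rwa [max_eq_left hx] at this

lemma notMem_classDK₁_of_hazard_sqrt_le {g : ℝ → ℝ} (hg : IsHazard g) {w : ℕ → ℝ}
    (hw : IsScale w) (hhg : ∀ x, hazard Real.sqrt w x ≤ g x + 1) : hg.dist ∉ classDK₁ :=
  hg.dist_notMem_classDK₁ fun x =>
    (le_add_of_nonneg_right (rampSum_nonneg hw x)).trans (hhg x)

end HalfLineDist

theorem theorem1p2 :
    ((HalfLineDist.classJ ∩ HalfLineDist.classK) \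
        (HalfLineDist.classL ∪ HalfLineDist.classD)).Nonempty ∧
    (((HalfLineDist.classJ ∩ HalfLineDist.classK) \
        (HalfLineDist.classL ∪ HalfLineDist.classD)) ∩ HalfLineDist.classDK₁).Nonempty ∧
    (((HalfLineDist.classJ ∩ HalfLineDist.classK) \
        (HalfLineDist.classL ∪ HalfLineDist.classD)) ∩ HalfLineDist.classDK₁ᶜ).Nonempty ∧
    (∃ F ∈ ((HalfLineDist.classJ ∩ HalfLineDist.classK) \
        (HalfLineDist.classL ∪ HalfLineDist.classD)) ∩ HalfLineDist.classDK₁,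
      F ∈ HalfLineDist.weakS) ∧
    (∃ F ∈ ((HalfLineDist.classJ ∩ HalfLineDist.classK) \
        (HalfLineDist.classL ∪ HalfLineDist.classD)) ∩ HalfLineDist.classDK₁,
      F ∉ HalfLineDist.weakS) ∧
    (∃ F ∈ ((HalfLineDist.classJ ∩ HalfLineDist.classK) \
        (HalfLineDist.classL ∪ HalfLineDist.classD)) ∩ HalfLineDist.classDK₁ᶜ,
      F ∈ HalfLineDist.weakS) ∧
    (∃ F ∈ ((HalfLineDist.classJ ∩ HalfLineDist.classK) \
        (HalfLineDist.classL ∪ HalfLineDist.classD)) ∩ HalfLineDist.classDK₁ᶜ,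
      F ∉ HalfLineDist.weakS) := by
  obtain ⟨_, hA, hA1, -, hA3, hA4⟩ := HalfLineDist.exists_mem_weakS HalfLineDist.isBase_log
  obtain ⟨_, hB, hB1, -, hB3, hB4⟩ := HalfLineDist.exists_notMem_weakS HalfLineDist.isBase_log
  obtain ⟨_, hC, -, hC2, hC3, hC4⟩ := HalfLineDist.exists_mem_weakS HalfLineDist.isBase_sqrt
  obtain ⟨_, hD, -, hD2, hD3, hD4⟩ := HalfLineDist.exists_notMem_weakS HalfLineDist.isBase_sqrt
  have hA5 := HalfLineDist.mem_classDK₁_of_le_hazard_log hA hA1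
  have hB5 := HalfLineDist.mem_classDK₁_of_le_hazard_log hB hB1
  have hC5 := HalfLineDist.notMem_classDK₁_of_hazard_sqrt_le hC HalfLineDist.isScale_add_one hC2
  have hD5 := HalfLineDist.notMem_classDK₁_of_hazard_sqrt_le hD HalfLineDist.isScale_one hD2
  exact ⟨⟨_, hA3⟩, ⟨_, hA3, hA5⟩, ⟨_, hC3, hC5⟩, ⟨_, ⟨hA3, hA5⟩, hA4⟩, ⟨_, ⟨hB3, hB5⟩, hB4⟩,
    ⟨_, ⟨hC3, hC5⟩, hC4⟩, ⟨_, ⟨hD3, hD5⟩, hD4⟩⟩
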